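/- Let $V=\{v_1,\dots,v_{n+m}\}$ be a finite set, let $E$ be a family of subsets of $V$ each having at least two elements, and let $w:E\to(0,\infty)$. Identify $\mathbb R^V$ with the Euclidean space $\mathbb R^{n+m}$. For $1\le p<\infty$ put $$f_e(x)=\max_{u,v\in e}\bigl(x(u)-x(v)\bigr),\qquad \varphi(x)=\frac1p\sum_{e\in E}w(e)\,f_e(x)^p\qquad(x\in\mathbb R^V).$$ Let $a_1,\dots,a_m\in\mathbb R$ be constants, let $$K_a=\{x\in\mathbb R^V:\ x_{n+j}=a_j,\ j=1,\dots,m\},$$ and let $I_{K_a}$ be the indicator function of $K_a$ ($0$ on $K_a$, $+\infty$ elsewhere). For $\psi:\mathbb R^V\to(-\infty,+\infty]$ write $\partial\psi(x)=\{\eta:\ \eta\cdot(z-x)\le\psi(z)-\psi(x)\ \ \forall z\in\mathbb R^V\}$, with $\partial\psi(x)=\emptyset$ where $\psi(x)=+\infty$, and let $R(A)=\bigcup_{y}A(y)$ be the range of a set-valued operator $A$. Let $h\in L^2_{\mathrm{loc}}([0,\infty);\mathbb R^V)$ have a weak derivative $h'\in L^1(0,\infty;\mathbb R^V)$, and let $h_\infty=\lim_{t\to\infty}h(t)$.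 For $x_0\in K_a$ let $x$ be the solution of $$x'(t)+\partial\varphi(x(t))+\partial I_{K_a}(x(t))\ni h(t)\quad\text{for a.e. } t>0,\qquad x(0)=x_0,$$ that belongs to $W^{1,2}(0,T;\mathbb R^V)$ for every $T>0$. If $h_\infty\in R(\partial\varphi+\partial I_{K_a})$ and $h-h_\infty\in L^1(0,\infty;\mathbb R^V)$, then $x(t)$ converges as $t\to\infty$ to a unique limit $x_\infty\in\mathbb R^V$, and $$\partial\varphi(x_\infty)+\partial I_{K_a}(x_\infty)\ni h_\infty ;$$ that is, the constant function $x_\infty$ is a (stationary) solution of the same problem with $h$ replaced by the constant $h_\infty$ and $x_0$ replaced by $x_\infty$. -/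

import Mathlib

open Set Filter Topology MeasureTheory
open scoped Pointwise ContDiff

noncomputable section

/-- A finite weighted hypergraph on the vertex set `V`: a family of hyperedges, each with at
least two vertices, and a positive weight on every hyperedge. -/
structure WeightedHypergraph (V : Type*) where
  edges : Finset (Finset V)
  two_le_card : ∀ e ∈ edges, 2 ≤ e.card
  weight : Finset V → ℝ
  weight_pos : ∀ e ∈ edges, 0 < weight e

namespace WeightedHypergraph

/-- `f_e(x) = max_{u, v ∈ e} (x(u) - x(v))`.  The supremum runs over a finite index set, which is
nonempty for a hyperedge `e`, so it is a maximum. -/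
def edgeMax {V : Type*} (e : Finset V) (x : EuclideanSpace ℝ V) : ℝ :=
  ⨆ q : e × e, (x q.1 - x q.2)

/-- `φ_{G,p}(x) = (1/p) ∑_{e ∈ E} w(e) f_e(x)^p`. -/
def energy {V : Type*} (G : WeightedHypergraph V) (p : ℝ) (x : EuclideanSpace ℝ V) : ℝ :=
  (1 / p) * ∑ e ∈ G.edges, G.weight e * (edgeMax e x) ^ p

end WeightedHypergraph

/-- The subdifferential at `x` of an extended-real-valued function `ψ`.  In `EReal`,
`ψ z - ⊤ = ⊥`, so the set is empty where `ψ x = ⊤`. -/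
def subdiff {F : Type*} [NormedAddCommGroup F] [InnerProductSpace ℝ F]
    (ψ : F → EReal) (x : F) : Set F :=
  {η | ∀ z : F, ((inner ℝ η (z - x) : ℝ) : EReal) ≤ ψ z - ψ x}

open Classical in
/-- The indicator function of a set: `0` on the set, `+∞` outside. -/
def indicatorFn {F : Type*} (K : Set F) (x : F) : EReal :=
  if x ∈ K then 0 else ⊤

/-- The constraint set `K_a`: the last `m` coordinates are prescribed to be `a₁, …, a_m`, the first
`n` coordinates are free. -/
def constraintSet (n : ℕ) {m : ℕ} (a : Fin m → ℝ) : Set (EuclideanSpace ℝ (Fin (n + m))) :=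
  {x | ∀ j : Fin m, x (Fin.natAdd n j) = a j}

/-- The set-valued operator `∂φ_{G,p} + ∂I_{K_a}`. -/
def constrainedLaplacian {n m : ℕ} (G : WeightedHypergraph (Fin (n + m))) (p : ℝ)
    (a : Fin m → ℝ) (x : EuclideanSpace ℝ (Fin (n + m))) :
    Set (EuclideanSpace ℝ (Fin (n + m))) :=
  subdiff (fun y => ((G.energy p y : ℝ) : EReal)) x + subdiff (indicatorFn (constraintSet n a)) x

/-- The range `R(A)` of a set-valued operator `A`. -/
def operatorRange {F : Type*} (A : F → Set F) : Set F :=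
  ⋃ x, A x

/-- `x` is a global solution, of class `W^{1,2}(0,T)` for every finite `T`, of
`x'(t) + ∂φ_{G,p}(x(t)) + ∂I_{K_{a(t)}}(x(t)) ∋ h(t)` for a.e. `t > 0`, `x(0) = x₀`.
Membership in `W^{1,2}(0,T)` is absolute continuity on `[0,T]` (so that the derivative exists
almost everywhere) together with a square-integrable derivative.  Values of `x`, `a` and `h` at
negative times play no role. -/
structure IsGlobalSolution {n m : ℕ} (G : WeightedHypergraph (Fin (n + m))) (p : ℝ)
    (a : ℝ → Fin m → ℝ) (h : ℝ → EuclideanSpace ℝ (Fin (n + m)))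
    (x₀ : EuclideanSpace ℝ (Fin (n + m))) (x : ℝ → EuclideanSpace ℝ (Fin (n + m))) : Prop where
  absolutelyContinuous : ∀ T : ℝ, 0 < T → AbsolutelyContinuousOnInterval x 0 T
  memLp_deriv : ∀ T : ℝ, 0 < T → MemLp (deriv x) 2 (volume.restrict (Ioo 0 T))
  initial : x 0 = x₀
  inclusion : ∀ᵐ t ∂(volume.restrict (Ioi (0 : ℝ))),
    h t ∈ {deriv x t} + constrainedLaplacian G p (a t) (x t)

/-- `g` is the weak (distributional) derivative of `u` on `(0, ∞)`. -/
def IsWeakDeriv {F : Type*} [NormedAddCommGroup F] [NormedSpace ℝ F] (u g : ℝ → F) : Prop :=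
  LocallyIntegrableOn u (Ioi (0 : ℝ)) ∧ LocallyIntegrableOn g (Ioi (0 : ℝ)) ∧
    ∀ ψ : ℝ → ℝ, ContDiff ℝ ∞ ψ → HasCompactSupport ψ → tsupport ψ ⊆ Ioi 0 →
      ∫ t in Ioi (0 : ℝ), deriv ψ t • u t = - ∫ t in Ioi (0 : ℝ), ψ t • g t

end

/-! Subtracting `h_inf` tilts the energy to `Φ = φ - ⟪h_inf, ·⟫` and leaves the integrable forcing
`g = h - h_inf`. That `h_inf` lies in the range says that `Φ` has a minimizer on `K_a`. The distance
from the flow to any minimizer grows by at most the integral of `‖g‖` (`norm_sub_le`), so the orbit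
is bounded. Were `Φ` to stay `ε` above its minimum, the squared distance would become negative
(`exists_ge_lt`); hence almost minimal values occur at arbitrarily late times, and compactness
yields a cluster point `y` that is itself a minimizer. The distance estimate, now centred at `y`,
upgrades this to convergence. The sum rule turns minimality of `y` back into the inclusion. -/

namespace WeightedHypergraph

variable {V : Type*}

lemma sub_le_edgeMax {e : Finset V} {u v : V} (hu : u ∈ e) (hv : v ∈ e)
    (x : EuclideanSpace ℝ V) : x u - x v ≤ edgeMax e x :=
  le_ciSup (f := fun q : e × e => x q.1 - x q.2) (Set.finite_range _).bddAbove (⟨u, hu⟩, ⟨v, hv⟩)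

lemma edgeMax_nonneg {e : Finset V} (he : e.Nonempty) (x : EuclideanSpace ℝ V) :
    0 ≤ edgeMax e x := by
  obtain ⟨u, hu⟩ := he
  simpa using sub_le_edgeMax hu hu x

lemma convexOn_edgeMax {e : Finset V} (he : e.Nonempty) : ConvexOn ℝ univ (edgeMax e) := by
  refine ⟨convex_univ, fun x _ y _ α β hα hβ _ => ?_⟩
  have : Nonempty e := he.to_subtype
  refine ciSup_le fun q => ?_
  have hx := mul_le_mul_of_nonneg_left (sub_le_edgeMax q.1.2 q.2.2 x) hα
  have hy := mul_le_mul_of_nonneg_left (sub_le_edgeMax q.1.2 q.2.2 y) hβ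
  simp only [PiLp.add_apply, PiLp.smul_apply, smul_eq_mul]
  linarith

/-- The power is convex and nondecreasing on `[0, ∞)`, where `edgeMax e` takes its values. -/
lemma convexOn_edgeMax_rpow {e : Finset V} (he : e.Nonempty) {p : ℝ} (hp : 1 ≤ p) :
    ConvexOn ℝ univ (fun x => edgeMax e x ^ p) := by
  refine ⟨convex_univ, fun x _ y _ α β hα hβ hαβ => ?_⟩
  calc edgeMax e (α • x + β • y) ^ p ≤ (α • edgeMax e x + β • edgeMax e y) ^ p :=
        Real.rpow_le_rpow (edgeMax_nonneg he _)
          ((convexOn_edgeMax he).2 trivial trivial hα hβ hαβ) (by linarith)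
    _ ≤ α • edgeMax e x ^ p + β • edgeMax e y ^ p :=
        (convexOn_rpow hp).2 (edgeMax_nonneg he x) (edgeMax_nonneg he y) hα hβ hαβ

lemma convexOn_energy (G : WeightedHypergraph V) {p : ℝ} (hp : 1 ≤ p) :
    ConvexOn ℝ univ (G.energy p) := by
  refine ⟨convex_univ, fun x _ y _ α β hα hβ hαβ => ?_⟩
  have hsum : ∑ e ∈ G.edges, G.weight e * edgeMax e (α • x + β • y) ^ p ≤
      α * ∑ e ∈ G.edges, G.weight e * edgeMax e x ^ p +
        β * ∑ e ∈ G.edges, G.weight e * edgeMax e y ^ p := by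
    rw [Finset.mul_sum, Finset.mul_sum, ← Finset.sum_add_distrib]
    refine Finset.sum_le_sum fun e he => ?_
    have hne : e.Nonempty := Finset.card_pos.1 (by have := G.two_le_card e he; omega)
    have h := mul_le_mul_of_nonneg_left
      ((convexOn_edgeMax_rpow hne hp).2 (mem_univ x) (mem_univ y) hα hβ hαβ)
      (G.weight_pos e he).le
    simp only [smul_eq_mul] at h
    linarith
  have hp0 : 0 ≤ 1 / p := by positivity
  have h := mul_le_mul_of_nonneg_left hsum hp0
  simp only [energy, smul_eq_mul]
  linarith

end WeightedHypergraph

/-! ### Subdifferentials and the sum rule -/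

section Subdifferential

variable {F : Type*} [NormedAddCommGroup F] [InnerProductSpace ℝ F]

lemma mem_subdiff_coe_iff {φ : F → ℝ} {x η : F} :
    η ∈ subdiff (fun y => (φ y : EReal)) x ↔ ∀ z, inner ℝ η (z - x) ≤ φ z - φ x := by
  simp only [subdiff, mem_ofPred_eq]
  exact forall_congr' fun z => by rw [← EReal.coe_sub, EReal.coe_le_coe_iff]

lemma mem_subdiff_indicatorFn_iff {K : Set F} {x η : F} :
    η ∈ subdiff (indicatorFn K) x ↔ x ∈ K ∧ ∀ z ∈ K, inner ℝ η (z - x) ≤ 0 := by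
  simp only [subdiff, mem_ofPred_eq]
  constructor
  · intro h
    have hx : x ∈ K := by
      by_contra hx
      have := h x
      simp [indicatorFn, hx] at this
    refine ⟨hx, fun z hz => ?_⟩
    have := h z
    simp only [indicatorFn, hx, hz, if_true, sub_zero] at this
    exact_mod_cast this
  · rintro ⟨hx, h⟩ z
    by_cases hz : z ∈ K
    · simp only [indicatorFn, hx, hz, if_true, sub_zero]
      exact_mod_cast h z hz
    · simp [indicatorFn, hx, hz]

lemma mem_and_inner_le_of_mem_subdiff_add {φ : F → ℝ} {K : Set F} {x ξ : F}
    (h : ξ ∈ subdiff (fun y => (φ y : EReal)) x + subdiff (indicatorFn K) x) :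
    x ∈ K ∧ ∀ z ∈ K, inner ℝ ξ (z - x) ≤ φ z - φ x := by
  obtain ⟨η, hη, ζ, hζ, rfl⟩ := Set.mem_add.1 h
  rw [mem_subdiff_coe_iff] at hη
  rw [mem_subdiff_indicatorFn_iff] at hζ
  refine ⟨hζ.1, fun z hz => ?_⟩
  rw [inner_add_left]
  linarith [hη z, hζ.2 z hz]

/-- The sum rule `∂(φ + I_K) ⊆ ∂φ + ∂I_K` for a continuous convex `φ` and a convex set `K`. -/
lemma mem_subdiff_add_of_forall_inner_le [CompleteSpace F] {φ : F → ℝ}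
    (hφ : ConvexOn ℝ univ φ) (hcont : Continuous φ) {K : Set F} (hK : Convex ℝ K) {x ξ : F}
    (hx : x ∈ K) (hmin : ∀ z ∈ K, inner ℝ ξ (z - x) ≤ φ z - φ x) :
    ξ ∈ subdiff (fun y => (φ y : EReal)) x + subdiff (indicatorFn K) x := by
  -- `x` minimizes `Ψ` on `K`, so the open strict epigraph of `Ψ` misses `K ×ˢ {Ψ x}` and
  -- Hahn-Banach separates them.
  let Ψ : F → ℝ := fun z => φ z - inner ℝ ξ (z - x)
  have hΨx : Ψ x = φ x := by simp [Ψ]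
  have hΨc : Continuous Ψ := by fun_prop
  have hΨ : ConvexOn ℝ univ Ψ := by
    refine ⟨convex_univ, fun u _ v _ α β hα hβ hαβ => ?_⟩
    have h := hφ.2 (mem_univ u) (mem_univ v) hα hβ hαβ
    have hsub : α • u + β • v - x = α • (u - x) + β • (v - x) := by
      have : x = α • x + β • x := by rw [← add_smul, hαβ, one_smul]
      nth_rewrite 1 [this]
      module
    simp only [Ψ, hsub, inner_add_right, inner_smul_right, smul_eq_mul] at h ⊢
    linarith
  have hs₁ : Convex ℝ {q : F × ℝ | Ψ q.1 < q.2} := by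
    simpa using hΨ.convex_strict_epigraph
  have hs₂ : IsOpen {q : F × ℝ | Ψ q.1 < q.2} :=
    isOpen_lt (hΨc.comp continuous_fst) continuous_snd
  have ht : Convex ℝ (K ×ˢ {Ψ x}) := hK.prod (convex_singleton _)
  have hdisj : Disjoint {q : F × ℝ | Ψ q.1 < q.2} (K ×ˢ {Ψ x}) := by
    rw [Set.disjoint_left]
    rintro ⟨z, r⟩ hz ⟨hzK, hr⟩
    simp only [mem_singleton_iff] at hr
    simp only [mem_ofPred_eq, hr, hΨx, Ψ] at hz
    linarith [hmin z hzK]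
  obtain ⟨f, u, hf₁, hf₂⟩ := geometric_hahn_banach_open hs₁ hs₂ ht hdisj
  set c : ℝ := f (0, 1) with hc
  let g : StrongDual ℝ F := f.comp (ContinuousLinearMap.inl ℝ F ℝ)
  have hfg : ∀ z r, f (z, r) = g z + r * c := by
    intro z r
    have : (z, r) = (z, (0 : ℝ)) + r • ((0 : F), (1 : ℝ)) := by simp
    rw [this, map_add, map_smul, smul_eq_mul, ← hc]
    rfl
  have hlow : ∀ k ∈ K, u ≤ g k + Ψ x * c := fun k hk => by
    rw [← hfg]; exact hf₂ _ ⟨hk, rfl⟩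
  have hup' : ∀ z r, Ψ z < r → g z + r * c < u := fun z r hr => by
    rw [← hfg]; exact hf₁ (z, r) hr
  -- The separating hyperplane is not vertical: compare the points above `x` at heights `Ψ x + 1`
  -- and `Ψ x`.
  have hc0 : c < 0 := by
    have h₁ := hup' x (Ψ x + 1) (by linarith)
    have h₂ := hlow x hx
    linarith
  have hup : ∀ z, g z + Ψ z * c ≤ u := by
    intro z
    refine le_of_forall_pos_lt_add fun ε hε => ?_
    have h := hup' z (Ψ z + ε / (-c)) (by have := div_pos hε (neg_pos.2 hc0); linarith)
    have : ε / (-c) * c = -ε := by field_simp [hc0.ne]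
    linarith
  -- The slope of the hyperplane: `η` is a subgradient of `Ψ` at `x`, and `-η` is normal to `K`
  -- there.
  let η : F := (InnerProductSpace.toDual ℝ F).symm ((-c)⁻¹ • g)
  have hη : ∀ z, inner ℝ η z = (-c)⁻¹ * g z := fun z => by
    simp only [η, InnerProductSpace.toDual_symm_apply, smul_apply, smul_eq_mul]
  have hcinv : 0 < (-c)⁻¹ := inv_pos.2 (neg_pos.2 hc0)
  have hcc : (-c)⁻¹ * c = -1 := by field_simp [hc0.ne]
  refine Set.mem_add.2 ⟨ξ + η, mem_subdiff_coe_iff.2 fun z => ?_, -η,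
    mem_subdiff_indicatorFn_iff.2 ⟨hx, fun z hz => ?_⟩, by abel⟩
  · have h := mul_le_mul_of_nonneg_left ((hup z).trans (hlow x hx)) hcinv.le
    have h₁ : (-c)⁻¹ * (g z + Ψ z * c) = (-c)⁻¹ * g z - Ψ z := by linear_combination Ψ z * hcc
    have h₂ : (-c)⁻¹ * (g x + Ψ x * c) = (-c)⁻¹ * g x - Ψ x := by linear_combination Ψ x * hcc
    rw [h₁, h₂, hΨx] at h
    rw [inner_add_left, hη, map_sub]
    simp only [Ψ] at h
    linarith
  · have h := mul_le_mul_of_nonneg_left ((hup x).trans (hlow z hz)) hcinv.le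
    rw [inner_neg_left, hη, map_sub]
    linarith

end Subdifferential

/-! ### Integrating almost-everywhere derivative bounds -/

section AbsolutelyContinuous

lemma AbsolutelyContinuousOnInterval.norm_sub_const {F : Type*} [NormedAddCommGroup F]
    {f : ℝ → F} {a b : ℝ} (hf : AbsolutelyContinuousOnInterval f a b) (c : F) :
    AbsolutelyContinuousOnInterval (fun t => ‖f t - c‖) a b := by
  refine squeeze_zero (fun E => Finset.sum_nonneg fun i _ => dist_nonneg) (fun E => ?_) hf
  refine Finset.sum_le_sum fun i _ => ?_
  rw [Real.dist_eq, dist_eq_norm]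
  simpa using abs_norm_sub_norm_le (f (E.2 i).1 - c) (f (E.2 i).2 - c)

lemma AbsolutelyContinuousOnInterval.sub_le_integral_of_ae_deriv_le {f g : ℝ → ℝ} {a b : ℝ}
    (hab : a ≤ b) (hf : AbsolutelyContinuousOnInterval f a b)
    (hg : IntervalIntegrable g volume a b) (hle : ∀ᵐ t, t ∈ Ioc a b → deriv f t ≤ g t) :
    f b - f a ≤ ∫ t in a..b, g t := by
  rw [← hf.integral_deriv_eq_sub]
  refine intervalIntegral.integral_mono_ae_restrict hab hf.intervalIntegrable_deriv hg ?_
  rw [EventuallyLE, ← restrict_Ioc_eq_restrict_Icc, ae_restrict_iff' measurableSet_Ioc]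
  exact hle

end AbsolutelyContinuous

lemma MeasureTheory.IntegrableOn.intervalIntegrable_norm {E : Type*} [NormedAddCommGroup E]
    {g : ℝ → E} (hg : IntegrableOn g (Ioi 0)) {s t : ℝ} (hs : 0 ≤ s)
    (hst : s ≤ t) : IntervalIntegrable (fun r => ‖g r‖) volume s t := by
  rw [intervalIntegrable_iff_integrableOn_Ioc_of_le hst]
  exact (IntegrableOn.mono_set hg fun r hr => lt_of_le_of_lt hs hr.1).norm

/-! ### Asymptotics of perturbed flows -/

section GradientFlow

variable {F : Type*} [NormedAddCommGroup F] [InnerProductSpace ℝ F]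

lemma hasDerivAt_half_norm_sub_sq {x : ℝ → F} {x' : F} {t : ℝ} (hx : HasDerivAt x x' t) (z : F) :
    HasDerivAt (fun s => ‖x s - z‖ ^ 2 / 2) (inner ℝ x' (x t - z)) t := by
  have h := ((hx.sub_const z).norm_sq).div_const 2
  rwa [mul_div_cancel_left₀ _ two_ne_zero, real_inner_comm] at h

/-- If the distance to `z` is differentiable at `t`, a bound for half the derivative of its square
yields a bound for its derivative, including at the zeros of the distance. -/
lemma deriv_norm_sub_le {x : ℝ → F} {z : F} {t c : ℝ} (hx : DifferentiableAt ℝ x t)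
    (hN : DifferentiableAt ℝ (fun s => ‖x s - z‖) t) (hc : 0 ≤ c)
    (hle : inner ℝ (deriv x t) (x t - z) ≤ c * ‖x t - z‖) :
    deriv (fun s => ‖x s - z‖) t ≤ c := by
  rcases (norm_nonneg (x t - z)).eq_or_lt with h0 | hpos
  · have hmin : IsLocalMin (fun s => ‖x s - z‖) t :=
      Eventually.of_forall fun s => by simp only [← h0]; positivity
    rw [hmin.deriv_eq_zero]
    exact hc
  · have h₁ := hasDerivAt_half_norm_sub_sq hx.hasDerivAt z
    have h₂ := (hN.hasDerivAt.pow 2).div_const 2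
    have h := h₁.unique h₂
    rw [h] at hle
    refine le_of_mul_le_mul_right (le_trans (le_of_eq ?_) hle) hpos
    simp
    ring

/-- Evolution variational inequality for the function `φ` on the set `K`:
`⟪g(t) - x'(t), z - x(t)⟫ ≤ φ(z) - φ(x(t))` for all `z ∈ K` and almost every `t > 0`. -/
structure IsPerturbedFlow (φ : F → ℝ) (K : Set F) (g x : ℝ → F) : Prop where
  ac : ∀ T : ℝ, 0 < T → AbsolutelyContinuousOnInterval x 0 T
  mem_ae : ∀ᵐ t, 0 < t → x t ∈ K
  inner_le : ∀ᵐ t, 0 < t → ∀ z ∈ K, inner ℝ (g t - deriv x t) (z - x t) ≤ φ z - φ (x t)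

namespace IsPerturbedFlow

variable {φ : F → ℝ} {K : Set F} {g x : ℝ → F}

lemma ac_Icc (hx : IsPerturbedFlow φ K g x) {s t : ℝ} (hs : 0 ≤ s) (hst : s ≤ t) :
    AbsolutelyContinuousOnInterval x s t := by
  -- `t + 1` because `t` may be `0`, while `ac` needs a positive endpoint.
  refine (hx.ac (t + 1) (by linarith)).mono ?_
  rw [uIcc_of_le hst, uIcc_of_le (by linarith)]
  exact Icc_subset_Icc hs (by linarith)

lemma inner_deriv_le (hx : IsPerturbedFlow φ K g x) {z : F} (hz : z ∈ K) :
    ∀ᵐ t, 0 < t →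
      inner ℝ (deriv x t) (x t - z) ≤ ‖g t‖ * ‖x t - z‖ - (φ (x t) - φ z) := by
  filter_upwards [hx.inner_le] with t ht ht0
  have h := ht ht0 z hz
  have h' := real_inner_le_norm (g t) (x t - z)
  rw [← neg_sub (x t) z, inner_neg_right, inner_sub_left] at h
  linarith

variable [FiniteDimensional ℝ F]

/-- Testing the variational inequality at a minimizer, the energy difference has the favourable
sign, so the distance has derivative at most `‖g‖`. -/
lemma norm_sub_le (hx : IsPerturbedFlow φ K g x) (hg : IntegrableOn g (Ioi 0)) {z : F}
    (hz : z ∈ K) (hmin : ∀ y ∈ K, φ z ≤ φ y) {s t : ℝ} (hs : 0 ≤ s) (hst : s ≤ t) :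
    ‖x t - z‖ ≤ ‖x s - z‖ + ∫ r in s..t, ‖g r‖ := by
  have hac := hx.ac_Icc hs hst
  have hN := hac.norm_sub_const z
  have h := hN.sub_le_integral_of_ae_deriv_le hst (hg.intervalIntegrable_norm hs hst) ?_
  · linarith
  filter_upwards [hac.boundedVariationOn.ae_differentiableAt_of_mem_uIcc, hN.ae_differentiableAt,
    hx.inner_deriv_le hz, hx.mem_ae] with r h₁ h₂ h₃ h₄ hr
  have hr' : r ∈ uIcc s t := by rw [uIcc_of_le hst]; exact Ioc_subset_Icc_self hr
  have hr0 : 0 < r := lt_of_le_of_lt hs hr.1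
  refine deriv_norm_sub_le (h₁ hr') (h₂ hr') (norm_nonneg _) ?_
  linarith [h₃ hr0, hmin _ (h₄ hr0)]

lemma norm_sub_le_add_integral (hx : IsPerturbedFlow φ K g x) (hg : IntegrableOn g (Ioi 0))
    {z : F} (hz : z ∈ K) (hmin : ∀ y ∈ K, φ z ≤ φ y) {s t : ℝ} (hs : 0 ≤ s) (hst : s ≤ t) :
    ‖x t - z‖ ≤ ‖x s - z‖ + ∫ r in Ioi s, ‖g r‖ := by
  refine (hx.norm_sub_le hg hz hmin hs hst).trans (add_le_add_right ?_ _)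
  rw [intervalIntegral.integral_of_le hst]
  exact setIntegral_mono_set (hg.mono_set (Ioi_subset_Ioi hs)).norm
    (Eventually.of_forall fun r => norm_nonneg _) Ioc_subset_Ioi_self.eventuallyLE

/-- The values of `φ` along the flow come arbitrarily close to the minimum at arbitrarily late
times. -/
lemma exists_ge_lt (hx : IsPerturbedFlow φ K g x) (hg : IntegrableOn g (Ioi 0)) {z : F}
    (hz : z ∈ K) (hmin : ∀ y ∈ K, φ z ≤ φ y) {s ε : ℝ} (hs : 0 ≤ s) (hε : 0 < ε) :
    ∃ t, s ≤ t ∧ x t ∈ K ∧ φ (x t) < φ z + ε := by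
  by_contra! hcon
  set M : ℝ := ‖x s - z‖ + ∫ r in Ioi s, ‖g r‖
  have hM : ∀ t, s ≤ t → ‖x t - z‖ ≤ M := fun t ht =>
    hx.norm_sub_le_add_integral hg hz hmin hs ht
  have hM0 : 0 ≤ M := (norm_nonneg _).trans (hM s le_rfl)
  have key : ∀ t, s ≤ t →
      ‖x t - z‖ ^ 2 / 2 - ‖x s - z‖ ^ 2 / 2 ≤ M * (∫ r in Ioi s, ‖g r‖) - ε * (t - s) := by
    intro t hst
    have hac := hx.ac_Icc hs hst
    have hN := hac.norm_sub_const z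
    have hsq : AbsolutelyContinuousOnInterval (fun r => ‖x r - z‖ ^ 2 / 2) s t := by
      convert (hN.mul hN).const_mul (1 / 2) using 2 with r
      simp only [Pi.mul_apply]
      ring
    have hgi := hg.intervalIntegrable_norm hs hst
    have h := hsq.sub_le_integral_of_ae_deriv_le (g := fun r => M * ‖g r‖ - ε) hst
      ((hgi.const_mul M).sub intervalIntegrable_const) ?_
    · refine h.trans ?_
      rw [intervalIntegral.integral_sub (hgi.const_mul M) intervalIntegrable_const,
        intervalIntegral.integral_const_mul, intervalIntegral.integral_const, smul_eq_mul,
        mul_comm (t - s), intervalIntegral.integral_of_le hst]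
      refine sub_le_sub_right (mul_le_mul_of_nonneg_left ?_ hM0) _
      exact setIntegral_mono_set (hg.mono_set (Ioi_subset_Ioi hs)).norm
        (Eventually.of_forall fun r => norm_nonneg _) Ioc_subset_Ioi_self.eventuallyLE
    filter_upwards [hac.boundedVariationOn.ae_differentiableAt_of_mem_uIcc,
      hx.inner_deriv_le hz, hx.mem_ae] with r h₁ h₃ h₄ hr
    have hr' : r ∈ uIcc s t := by rw [uIcc_of_le hst]; exact Ioc_subset_Icc_self hr
    have hr0 : 0 < r := lt_of_le_of_lt hs hr.1
    rw [(hasDerivAt_half_norm_sub_sq (h₁ hr').hasDerivAt z).deriv]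
    have h₅ := hcon r hr.1.le (h₄ hr0)
    have h₆ := mul_le_mul_of_nonneg_left (hM r hr.1.le) (norm_nonneg (g r))
    linarith [h₃ hr0]
  set C : ℝ := ‖x s - z‖ ^ 2 / 2 + M * ∫ r in Ioi s, ‖g r‖ with hCdef
  have hC : 0 ≤ C := by
    have : 0 ≤ ∫ r in Ioi s, ‖g r‖ := integral_nonneg fun r => norm_nonneg (g r)
    positivity
  -- At this time the loss `ε * (t - s)` equals `C + 1`, forcing half the squared distance down to
  -- at most `-1`.
  have h := key (s + (C + 1) / ε) (by have : 0 ≤ (C + 1) / ε := by positivity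
                                      linarith)
  have h' : ε * (s + (C + 1) / ε - s) = C + 1 := by field_simp; ring
  rw [h'] at h
  have := sq_nonneg ‖x (s + (C + 1) / ε) - z‖
  linarith

/-- A perturbed flow of a continuous function on a closed set with an integrable perturbation
converges to a minimizer as soon as there is one. -/
theorem exists_tendsto (hx : IsPerturbedFlow φ K g x) (hφ : Continuous φ) (hK : IsClosed K)
    (hg : IntegrableOn g (Ioi 0)) {z : F} (hz : z ∈ K) (hmin : ∀ y ∈ K, φ z ≤ φ y) :
    ∃ y ∈ K, (∀ y' ∈ K, φ y ≤ φ y') ∧ Tendsto x atTop (𝓝 y) := by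
  choose τ hτ hτK hτφ using fun k : ℕ =>
    hx.exists_ge_lt hg hz hmin (Nat.cast_nonneg k) (Nat.one_div_pos_of_nat (α := ℝ) (n := k))
  have hτ0 : ∀ k, 0 ≤ τ k := fun k => (Nat.cast_nonneg k).trans (hτ k)
  obtain ⟨y, -, σ, hσ, hy⟩ := tendsto_subseq_of_bounded
    (Metric.isBounded_closedBall (x := z) (r := ‖x 0 - z‖ + ∫ r in Ioi 0, ‖g r‖))
    (x := fun k => x (τ k)) fun k => by
      rw [mem_closedBall_iff_norm]
      exact hx.norm_sub_le_add_integral hg hz hmin le_rfl (hτ0 k)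
  have hyK : y ∈ K := hK.mem_of_tendsto hy (Eventually.of_forall fun k => hτK _)
  have hyz : φ y ≤ φ z := by
    have h₁ : Tendsto (fun k => φ (x (τ (σ k)))) atTop (𝓝 (φ y)) := (hφ.tendsto y).comp hy
    have h₂ : Tendsto (fun k => φ z + 1 / ((σ k : ℝ) + 1)) atTop (𝓝 (φ z + 0)) :=
      tendsto_const_nhds.add (tendsto_one_div_add_atTop_nhds_zero_nat.comp hσ.tendsto_atTop)
    rw [add_zero] at h₂
    exact le_of_tendsto_of_tendsto' h₁ h₂ fun k => (hτφ _).le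
  have hymin : ∀ y' ∈ K, φ y ≤ φ y' := fun y' hy' => hyz.trans (hmin y' hy')
  refine ⟨y, hyK, hymin, ?_⟩
  have hτσ : Tendsto (fun k => τ (σ k)) atTop atTop :=
    tendsto_atTop_mono (fun k => hτ (σ k))
      (tendsto_natCast_atTop_atTop.comp hσ.tendsto_atTop)
  have htail : Tendsto (fun k => ∫ r in (0 : ℝ)..τ (σ k), ‖g r‖) atTop
      (𝓝 (∫ r in Ioi 0, ‖g r‖)) := intervalIntegral_tendsto_integral_Ioi 0 hg.norm hτσ
  have hdist : Tendsto (fun k => ‖x (τ (σ k)) - y‖) atTop (𝓝 0) :=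
    tendsto_iff_norm_sub_tendsto_zero.1 hy
  -- Distance to `y` at time `τ (σ k)` plus the mass of `‖g‖` still to come: this bounds the
  -- distance to `y` at all later times.
  have hsum := hdist.add ((tendsto_const_nhds (x := ∫ r in Ioi 0, ‖g r‖)).sub htail)
  rw [sub_self, add_zero] at hsum
  rw [Metric.tendsto_atTop]
  intro ε hε
  obtain ⟨k, hk⟩ := (hsum.eventually_lt_const hε).exists
  refine ⟨τ (σ k), fun t ht => ?_⟩
  rw [dist_eq_norm]
  refine ((hx.norm_sub_le_add_integral hg hyK hymin (hτ0 _) ht).trans_eq ?_).trans_lt hk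
  rw [← intervalIntegral.integral_interval_add_Ioi hg.norm
    (hg.mono_set (Ioi_subset_Ioi (hτ0 (σ k)))).norm]
  ring

end IsPerturbedFlow

end GradientFlow

/-! ### Application to the constrained hypergraph Laplacian -/

section Hypergraph

lemma convex_constraintSet (n : ℕ) {m : ℕ} (a : Fin m → ℝ) : Convex ℝ (constraintSet n a) := by
  intro x hx y hy α β _ _ hαβ j
  simp only [PiLp.add_apply, PiLp.smul_apply, smul_eq_mul, hx j, hy j]
  rw [← add_mul, hαβ, one_mul]

lemma isClosed_constraintSet (n : ℕ) {m : ℕ} (a : Fin m → ℝ) : IsClosed (constraintSet n a) := by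
  have : constraintSet n a = ⋂ j : Fin m, {x | x (Fin.natAdd n j) = a j} := by
    ext x
    simp [constraintSet]
  rw [this]
  exact isClosed_iInter fun j => isClosed_eq (by fun_prop) continuous_const

/-- Stationary points solve the evolution problem. -/
lemma isGlobalSolution_const {n m : ℕ} {G : WeightedHypergraph (Fin (n + m))} {p : ℝ}
    {a : Fin m → ℝ} {ξ y : EuclideanSpace ℝ (Fin (n + m))}
    (h : ξ ∈ constrainedLaplacian G p a y) :
    IsGlobalSolution G p (fun _ => a) (fun _ => ξ) y (fun _ => y) where
  absolutelyContinuous T _ :=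
    ((LipschitzWith.const y).lipschitzOnWith (s := uIcc 0 T)).absolutelyContinuousOnInterval
  memLp_deriv T _ := by simp
  initial := rfl
  inclusion := Eventually.of_forall fun t => by simpa using h

/-- A solution with right-hand side `h` is a perturbed flow of the tilted energy
`φ - ⟪η, ·⟫`, the perturbation being `h - η`. -/
lemma IsGlobalSolution.isPerturbedFlow {n m : ℕ} {G : WeightedHypergraph (Fin (n + m))} {p : ℝ}
    {a : Fin m → ℝ} {h x : ℝ → EuclideanSpace ℝ (Fin (n + m))}
    {x₀ : EuclideanSpace ℝ (Fin (n + m))} (hx : IsGlobalSolution G p (fun _ => a) h x₀ x)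
    (η : EuclideanSpace ℝ (Fin (n + m))) :
    IsPerturbedFlow (fun z => G.energy p z - inner ℝ η z) (constraintSet n a)
      (fun t => h t - η) x := by
  have hincl : ∀ᵐ t, 0 < t → x t ∈ constraintSet n a ∧ ∀ z ∈ constraintSet n a,
      inner ℝ (h t - deriv x t) (z - x t) ≤ G.energy p z - G.energy p (x t) := by
    filter_upwards [(ae_restrict_iff' measurableSet_Ioi).1 hx.inclusion] with t ht ht0
    obtain ⟨_, rfl, ζ, hζ, hsum⟩ := Set.mem_add.1 (ht ht0)
    rw [← hsum, add_sub_cancel_left]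
    exact mem_and_inner_le_of_mem_subdiff_add hζ
  refine ⟨hx.absolutelyContinuous, hincl.mono fun t ht ht0 => (ht ht0).1,
    hincl.mono fun t ht ht0 z hz => ?_⟩
  have h₁ := (ht ht0).2 z hz
  rw [sub_right_comm, inner_sub_left, inner_sub_right η]
  linarith

end Hypergraph

theorem proposition5p1 {n m : ℕ} (G : WeightedHypergraph (Fin (n + m))) (p : ℝ) (hp : 1 ≤ p)
    (a : Fin m → ℝ)
    (h : ℝ → EuclideanSpace ℝ (Fin (n + m))) (h_inf : EuclideanSpace ℝ (Fin (n + m)))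
    -- `h ∈ L²_loc`
    (hA1 : ∀ T : ℝ, 0 < T → MemLp h 2 (volume.restrict (Ioo 0 T)))
    -- `h' ∈ L¹(0, ∞)`
    (hA2 : ∃ h' : ℝ → EuclideanSpace ℝ (Fin (n + m)),
      IsWeakDeriv h h' ∧ IntegrableOn h' (Ioi (0 : ℝ)))
    -- `h_inf = lim_{t → ∞} h(t)`, up to null sets, as `h` is determined only almost everywhere
    (h_lim : Tendsto h (atTop ⊓ ae volume) (𝓝 h_inf))
    (h_range : h_inf ∈ operatorRange (constrainedLaplacian G p a))
    (h_L1 : IntegrableOn (fun t => h t - h_inf) (Ioi (0 : ℝ)))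
    (x₀ : EuclideanSpace ℝ (Fin (n + m))) (hx₀ : x₀ ∈ constraintSet n a)
    (x : ℝ → EuclideanSpace ℝ (Fin (n + m)))
    (hx : IsGlobalSolution G p (fun _ => a) h x₀ x) :
    ∃ x_inf : EuclideanSpace ℝ (Fin (n + m)),
      Tendsto x atTop (𝓝 x_inf) ∧
      (∀ y : EuclideanSpace ℝ (Fin (n + m)), Tendsto x atTop (𝓝 y) → y = x_inf) ∧
      h_inf ∈ constrainedLaplacian G p a x_inf ∧
      IsGlobalSolution G p (fun _ => a) (fun _ => h_inf) x_inf (fun _ => x_inf) := by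
  obtain ⟨z, hz⟩ := mem_iUnion.1 h_range
  obtain ⟨hzK, hzmin⟩ := mem_and_inner_le_of_mem_subdiff_add hz
  have hconv := G.convexOn_energy hp
  have hcont : Continuous (G.energy p) := hconv.locallyLipschitz.continuous
  obtain ⟨y, hyK, hymin, hy⟩ := (hx.isPerturbedFlow h_inf).exists_tendsto (by fun_prop)
    (isClosed_constraintSet n a) h_L1 hzK fun w hw => by
      have := hzmin w hw
      rw [inner_sub_right] at this
      linarith
  have hmem : h_inf ∈ constrainedLaplacian G p a y := by
    refine mem_subdiff_add_of_forall_inner_le hconv hcont (convex_constraintSet n a) hyK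
      fun w hw => ?_
    have := hymin w hw
    rw [inner_sub_right]
    linarith
  exact ⟨y, hy, fun w hw => tendsto_nhds_unique hw hy, hmem, isGlobalSolution_const hmem⟩
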